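/- Let $\mathcal M$ be a compact $d$-dimensional smooth Riemannian manifold with boundary ($d\ge 1$), and let $A_1,\dots,A_n$ be elementary boundary regions, i.e. codimension-0 regions of $\partial\mathcal M$ (closed, equal to the closure of their relative interior, with relative boundary of zero $(d-1)$-dimensional area) whose relative interiors are pairwise disjoint and whose union is $\partial\mathcal M$. For $I\subseteq[n]=\{1,\dots,n\}$ put $A_I=\bigcup_{i\in I}A_i$ and $\bar I=[n]\setminus I$, and let the entropy $S(A_I)$ be the least area (infimum) of a surface homologous to $A_I$, i.e. of the frontier in $\mathcal M$ of a closed bulk region $r$ that is the closure of its interior and satisfies $r\cap\partial\mathcal M=A_I$. A curve is a rectifiable path of positive finite length. A thread is an unoriented curve that has both endpoints on $\partial\mathcal M$ or is closed. A thread configuration is a family of threads together with a measure on the index set of the family that counts them (such that the length of a thread in a Borel set, and whether it connects two Borel sets, depend measurably on the thread). $N_{A:B}$ denotes the number (measure) of threads having one endpoint in $A$ and the other in $B$. The volume density at $x\in\mathcal M$ is $$\nu_v(x)=\limsup_{r\to0^+}\frac{\text{total length of threads contained in the ball }B(x,r)}{\operatorname{vol}B(x,r)} .$$ Let $\mathcal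 I$ be a set of subsets of $[n]$, let $n_{ij}=|\{I\in\mathcal I: i\in I,\ j\notin I\}|$ and $N_{ij}=n_{ij}+n_{ji}$. Let $\lambda:\mathcal M\to\mathbb R$ be a Borel measurable function with $\lambda\ge0$ and $$\int_c ds\,\lambda\ \ge\ N_{ij}\qquad\text{for all } i,j \text{ and every curve } c \text{ from the relative interior of } A_i \text{ to the relative interior of } A_j .$$ Then for every thread configuration with $\nu_v\le1$ everywhere on $\mathcal M$, $$\int_{\mathcal M}\sqrt g\,\lambda\ \ge\ \sum_{I\in\mathcal I}N_{A_I:A_{\bar I}} .$$ Consequently, if $\int_{\mathcal M}\sqrt g\,\lambda<\sum_{I\in\mathcal I}S(A_I)$, then no thread configuration with $\nu_v\le1$ everywhere locks $\mathcal I$, i.e. satisfies $N_{A_I:A_{\bar I}}=S(A_I)$ for all $I\in\mathcal I$. (Integrals, areas and numbers of threads take values in $[0,\infty]$.) -/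

import Mathlib

open scoped Bundle Manifold ContDiff ENNReal Topology MeasureTheory

noncomputable section

namespace BitThreads

/-! ### Curves in an extended metric space -/

/-- A curve in `M`: a rectifiable path of positive finite length, given by its parametrization by
arc length on `[0, length]` (the values of `toFun` outside this interval play no role).
Every non-constant rectifiable path, in particular every piecewise smooth one, has such a
parametrization. -/
structure Curve (M : Type*) [PseudoEMetricSpace M] where
  toFun : ℝ → M
  length : ℝ
  length_pos : 0 < length
  unitSpeed : HasUnitSpeedOn toFun (Set.Icc 0 length)

namespace Curve

variable {M : Type*} [PseudoEMetricSpace M]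

/-- The initial point of the parametrization. -/
def source (c : Curve M) : M := c.toFun 0

/-- The final point of the parametrization. -/
def target (c : Curve M) : M := c.toFun c.length

/-- `c` goes from `A` to `B`. -/
def IsFromTo (c : Curve M) (A B : Set M) : Prop := c.source ∈ A ∧ c.target ∈ B

/-- `c`, taken without orientation, connects `A` and `B`. -/
def Connects (c : Curve M) (A B : Set M) : Prop := c.IsFromTo A B ∨ c.IsFromTo B A

/-- The line integral `∫_c ds f` of a nonnegative function with respect to arc length. -/
def lineIntegral (c : Curve M) (f : M → ℝ≥0∞) : ℝ≥0∞ :=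
  ∫⁻ s in Set.Icc 0 c.length, f (c.toFun s)

/-- The length of the part of `c` that lies in `B`. -/
def lengthIn (c : Curve M) (B : Set M) : ℝ≥0∞ :=
  MeasureTheory.volume (Set.Icc 0 c.length ∩ c.toFun ⁻¹' B)

end Curve

/-! ### Volume, area, boundary regions, entropy

Below, `M` is a `d`-dimensional Riemannian manifold with boundary, whose distance is the Riemannian
one. For every `k`, the `k`-dimensional Riemannian volume of subsets is the `k`-dimensional
Hausdorff measure of this distance, in the normalization `μHE[k]` that agrees with Lebesgue measure
on `ℝᵏ`. -/

/-- The boundary `∂M` of a `d`-dimensional manifold with boundary. -/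
abbrev bdry (d : ℕ) [NeZero d] (M : Type*) [TopologicalSpace M]
    [ChartedSpace (EuclideanHalfSpace d) M] : Set M :=
  (𝓡∂ d).boundary M

/-- The Riemannian volume measure of a `d`-dimensional Riemannian manifold. -/
def riemVolume (d : ℕ) (M : Type*) [EMetricSpace M] [MeasurableSpace M] [BorelSpace M] :
    MeasureTheory.Measure M := μHE[d]

/-- The area measure for hypersurfaces of a `d`-dimensional Riemannian manifold. -/
def area (d : ℕ) {M : Type*} [EMetricSpace M] [MeasurableSpace M] [BorelSpace M]
    (s : Set M) : ℝ≥0∞ := (μHE[d - 1] : MeasureTheory.Measure M) s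

section Regions

variable (d : ℕ) [NeZero d] {M : Type*} [EMetricSpace M] [MeasurableSpace M] [BorelSpace M]
  [ChartedSpace (EuclideanHalfSpace d) M]

/-- The interior of `A` relative to `∂M`. -/
def bdryInterior (A : Set M) : Set M := {x ∈ bdry d M | A ∈ 𝓝[bdry d M] x}

/-- A boundary region: a closed subset of `∂M` of codimension 0, i.e. equal to the closure of its
relative interior, whose relative boundary has vanishing `(d - 1)`-dimensional area. Every compact
codimension-0 embedded submanifold-with-boundary of `∂M` (possibly with corners) is of this kind. -/
structure IsBdryRegion (A : Set M) : Prop where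
  subset_bdry : A ⊆ bdry d M
  isClosed : IsClosed A
  subset_closure : A ⊆ closure (bdryInterior d A)
  area_bdry : area d (A \ bdryInterior d A) = 0

/-- The `A i` are elementary regions: boundary regions that cover `∂M` and do not overlap, which
means that their interiors do not intersect. -/
structure IsElementary {n : ℕ} (A : Fin n → Set M) : Prop where
  isBdryRegion : ∀ i, IsBdryRegion d (A i)
  nonoverlapping : ∀ i j, i ≠ j → Disjoint (bdryInterior d (A i)) (bdryInterior d (A j))
  cover : ⋃ i, A i = bdry d M

/-- `r` is a bulk region that meets `∂M` in `A`. Its boundary is then `A ∪ frontier r`, where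
`frontier r` is the topological frontier in `M`; so `frontier r` is a surface homologous to `A`. -/
structure IsHomologyRegion (A r : Set M) : Prop where
  isClosed : IsClosed r
  subset_closure : r ⊆ closure (interior r)
  inter_bdry : r ∩ bdry d M = A

/-- The entropy `S(A)`: the least area of a surface homologous to `A` (as an infimum, so that no
existence or uniqueness of a minimal surface has to be assumed). -/
def entropy (A : Set M) : ℝ≥0∞ :=
  ⨅ (r : Set M) (_ : IsHomologyRegion d A r), area d (frontier r)

end Regions

/-- The composite region `A_I`. -/
def composite {M : Type*} {n : ℕ} (A : Fin n → Set M) (I : Finset (Fin n)) : Set M :=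
  ⋃ i ∈ I, A i

/-- `n_ij`: the number of members of the family that contain `i` and not `j`. -/
def sepCount {n : ℕ} (F : Finset (Finset (Fin n))) (i j : Fin n) : ℕ :=
  (F.filter fun I => i ∈ I ∧ j ∉ I).card

/-- `N_ij = n_ij + n_ji`. -/
def symSepCount {n : ℕ} (F : Finset (Finset (Fin n))) (i j : Fin n) : ℕ :=
  sepCount F i j + sepCount F j i

/-! ### Thread configurations -/

section Threads

variable (d : ℕ) [NeZero d] {M : Type*} [EMetricSpace M] [MeasurableSpace M] [BorelSpace M]
  [ChartedSpace (EuclideanHalfSpace d) M]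

/-- A thread is a curve without endpoints in the interior of `M`: it ends on `∂M` or is closed. -/
def IsThread (c : Curve M) : Prop :=
  (c.source ∈ bdry d M ∧ c.target ∈ bdry d M) ∨ c.source = c.target

variable (M) in
/-- A thread configuration: a family of threads, indexed by a type `T`, with a measure `count` on
`T` that counts them. The length in a given set and whether given sets are connected must
depend measurably on the thread. -/
structure ThreadConfiguration (T : Type*) [MeasurableSpace T] where
  thread : T → Curve M
  isThread : ∀ t, IsThread d (thread t)
  count : MeasureTheory.Measure T
  measurable_lengthIn : ∀ B, MeasurableSet B → Measurable fun t => (thread t).lengthIn B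
  measurableSet_connects : ∀ A B, MeasurableSet A → MeasurableSet B →
    MeasurableSet {t | (thread t).Connects A B}

namespace ThreadConfiguration

variable {d} {T : Type*} [MeasurableSpace T]

/-- `N_{A:B}`: the number of threads that connect `A` and `B`. -/
def number (K : ThreadConfiguration d M T) (A B : Set M) : ℝ≥0∞ :=
  K.count {t | (K.thread t).Connects A B}

/-- The total length of threads contained in `B`. -/
def totalLength (K : ThreadConfiguration d M T) (B : Set M) : ℝ≥0∞ :=
  ∫⁻ t, (K.thread t).lengthIn B ∂K.count

/-- The volume density `ν_v` at `x`: the total length of threads contained in a small ball around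
`x` divided by the volume of the ball, in the limit (superior) of small radius. -/
def volumeDensity (K : ThreadConfiguration d M T) (x : M) : ℝ≥0∞ :=
  Filter.limsup
    (fun r : ℝ≥0∞ => K.totalLength (Metric.eball x r) / riemVolume d M (Metric.eball x r))
    (𝓝[>] 0)

/-- `N_{A_I:A_Ī}`, where `Ī` is the complement of `I` in the index set. -/
def crossNumber (K : ThreadConfiguration d M T) {n : ℕ} (A : Fin n → Set M)
    (I : Finset (Fin n)) : ℝ≥0∞ :=
  K.number (composite A I) (composite A Iᶜ)

/-- The configuration locks `A_I`: as many threads as possible, namely `S(A_I)`, connect `A_I` to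
its complement. -/
def Locks (K : ThreadConfiguration d M T) {n : ℕ} (A : Fin n → Set M)
    (I : Finset (Fin n)) : Prop :=
  K.crossNumber A I = entropy d (composite A I)

end ThreadConfiguration

/-- `lam` satisfies the path constraints `∫_c ds lam ≥ N_ij` on all curves `c` from (the interior
of) `A_i` to (the interior of) `A_j`. -/
def PathConstraints {n : ℕ} (A : Fin n → Set M) (F : Finset (Finset (Fin n)))
    (lam : M → ℝ) : Prop :=
  ∀ i j : Fin n, ∀ c : Curve M, c.IsFromTo (bdryInterior d (A i)) (bdryInterior d (A j)) →
    (symSepCount F i j : ℝ≥0∞) ≤ c.lineIntegral fun x => ENNReal.ofReal (lam x)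

end Threads

end BitThreads

end

/-! Double counting. A thread from `A i` to `A j` crosses from `A_I` to its complement only if `I`
contains exactly one of `i`, `j`, hence for at most `N_ij` members of the family, and this is at
most the line integral of `lam` along the thread (`PathConstraints.card_connects_le`). Integrating
over threads bounds the sum of the crossing numbers by the integral of `lam` against
`lengthMeasure`, the measure "total length of threads". The density bound gives `lengthMeasure ≤
riemVolume`, and the inequality follows. If every member were locked, the left side would be the sum
of the entropies, whence the second claim.

Two points need analysis, and both rest on the volume of a small ball of radius `r` being comparable
to `r ^ d` (`exists_eball_volume_bounds`), which holds because charts are locally bi-Lipschitz.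

Density: the pointwise bound on the upper density becomes an inequality of measures by Vitali
covering, once absolute continuity and doubling are known (`le_of_limsup_eball_le_one`).

Endpoints: the path constraints concern only curves that end in relative interiors. Threads ending
on a relative boundary form a null set (`count_endpoint_mem_eq_zero`): a thread that is not too
short and ends in a ball of radius `r` has length at least `r` in the doubled ball, which holds
total length `O(r ^ d)`. So `O(r ^ (d - 1))` such threads end in the ball, and a set of zero area
receives none, up to measure zero. -/

/-! ### Local bounds for trivializations of a Riemannian vector bundle. -/

section BundleBounds

open Set Bundle
open scoped NNReal

variable {B : Type*} [TopologicalSpace B] (F : Type*) [NormedAddCommGroup F] [NormedSpace ℝ F]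
  (E : B → Type*) [TopologicalSpace (TotalSpace F E)]
  [∀ x, NormedAddCommGroup (E x)] [∀ x, InnerProductSpace ℝ (E x)] [FiberBundle F E]
  [VectorBundle ℝ F E] [IsContinuousRiemannianBundle F E]

theorem eventually_enorm_trivializationAt_apply_le (x : B) :
    ∃ C > (0 : ℝ≥0), ∀ᶠ y in 𝓝 x, ∀ v : E y,
      ‖(trivializationAt F E x).continuousLinearMapAt ℝ y v‖ₑ ≤ C * ‖v‖ₑ := by
  obtain ⟨C, C_pos, hC⟩ := eventually_norm_trivializationAt_lt F E x
  lift C to ℝ≥0 using C_pos.le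
  refine ⟨C, by exact_mod_cast C_pos, ?_⟩
  filter_upwards [hC] with y hy v
  have h := ((trivializationAt F E x).continuousLinearMapAt ℝ y).le_of_opNorm_le hy.le v
  simp only [enorm_eq_nnnorm]
  exact_mod_cast h

theorem eventually_enorm_symmL_trivializationAt_apply_le (x : B) :
    ∃ C > (0 : ℝ≥0), ∀ᶠ y in 𝓝 x, ∀ v : F,
      ‖(trivializationAt F E x).symmL ℝ y v‖ₑ ≤ C * ‖v‖ₑ := by
  obtain ⟨C, C_pos, hC⟩ := eventually_norm_symmL_trivializationAt_lt F E x
  lift C to ℝ≥0 using C_pos.le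
  refine ⟨C, by exact_mod_cast C_pos, ?_⟩
  filter_upwards [hC] with y hy v
  have h := ((trivializationAt F E x).symmL ℝ y).le_of_opNorm_le hy.le v
  simp only [enorm_eq_nnnorm]
  exact_mod_cast h

end BundleBounds

/-! ### Charts are locally bi-Lipschitz for the Riemannian distance. -/

section ChartLipschitz

open Set Metric MeasureTheory Manifold
open scoped NNReal

variable {E : Type*} [NormedAddCommGroup E] [NormedSpace ℝ E]
  {H : Type*} [TopologicalSpace H] (I : ModelWithCorners ℝ E H)
  {M : Type*}

section

variable [TopologicalSpace M] [ChartedSpace H M]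
  [Bundle.RiemannianBundle (fun x : M => TangentSpace I x)]
  [IsManifold I 1 M] [IsContinuousRiemannianBundle E (fun x : M => TangentSpace I x)]

/-- Over the chart domain, the derivative of the chart is the trivialization of the tangent bundle,
which is locally bounded. -/
theorem eventually_enorm_mfderiv_extChartAt_apply_le (x : M) :
    ∃ C > (0 : ℝ≥0), ∀ᶠ y in 𝓝 x, ∀ v : TangentSpace I y,
      ‖(show E from mfderiv% (extChartAt I x) y v)‖ₑ ≤ C * ‖v‖ₑ := by
  obtain ⟨C, C_pos, hC⟩ := eventually_enorm_trivializationAt_apply_le E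
    (fun y : M => TangentSpace I y) x
  refine ⟨C, C_pos, ?_⟩
  filter_upwards [hC, chart_source_mem_nhds H x] with y hy h'y v
  rw [← TangentBundle.continuousLinearMapAt_trivializationAt h'y]
  exact hy v

theorem eventually_enorm_mfderivWithin_extChartAt_symm_apply_le (x : M) :
    ∃ C > (0 : ℝ≥0), ∀ᶠ p in 𝓝[range I] (extChartAt I x x), ∀ v : E,
      ‖mfderiv[range I] (extChartAt I x).symm p v‖ₑ ≤ C * ‖v‖ₑ := by
  obtain ⟨C, C_pos, hC⟩ := eventually_enorm_symmL_trivializationAt_apply_le E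
    (fun y : M => TangentSpace I y) x
  refine ⟨C, C_pos, ?_⟩
  have hcont := continuousAt_extChartAt_symm (I := I) x
  rw [ContinuousAt, extChartAt_to_inv] at hcont
  have hC' := hC.and (chart_source_mem_nhds H x)
  filter_upwards [nhdsWithin_le_nhds (hcont.eventually hC'),
    extChartAt_target_mem_nhdsWithin x] with p hp hpt v
  obtain ⟨hp, hps⟩ := hp
  have h := hp v
  rw [TangentBundle.symmL_trivializationAt hps] at h
  -- The fibre norm depends on the base point, so the derivatives at `p` and at its round trip
  -- through the chart are compared as vectors of `E`.
  have heq : (show E from mfderiv[range I] (extChartAt I x).symm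
      (extChartAt I x ((extChartAt I x).symm p)) v) =
      (show E from mfderiv[range I] (extChartAt I x).symm p v) :=
    congrArg (fun q => (show E from mfderiv[range I] (extChartAt I x).symm q v))
      ((extChartAt I x).right_inv hpt)
  exact (congrArg (fun w : TangentSpace I ((extChartAt I x).symm p) => ‖w‖ₑ) heq.symm).le.trans h

end

variable [PseudoEMetricSpace M] [ChartedSpace H M]
  [Bundle.RiemannianBundle (fun x : M => TangentSpace I x)]
  [IsManifold I 1 M] [IsContinuousRiemannianBundle E (fun x : M => TangentSpace I x)]
  [IsRiemannianManifold I M]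

/-- The inverse of an extended chart is locally Lipschitz for the Riemannian distance. -/
theorem exists_lipschitzOnWith_extChartAt_symm (x : M) :
    ∃ C > (0 : ℝ≥0), ∃ r > (0 : ℝ), ball (extChartAt I x x) r ∩ range I ⊆ (extChartAt I x).target ∧
      LipschitzOnWith C (extChartAt I x).symm (ball (extChartAt I x x) r ∩ range I) := by
  rcases eventually_enorm_mfderivWithin_extChartAt_symm_apply_le I x with ⟨C, C_pos, hC⟩
  obtain ⟨r, r_pos, hr⟩ := mem_nhdsWithin_iff.1
    (Filter.inter_mem (extChartAt_target_mem_nhdsWithin x) hC)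
  refine ⟨C, C_pos, r, r_pos, hr.trans inter_subset_left, fun p hp q hq => ?_⟩
  -- The segment stays in the convex set `ball ∩ range I`; the length of its image in `M` bounds the
  -- distance.
  let η := ContinuousAffineMap.lineMap (R := ℝ) p q
  set γ := (extChartAt I x).symm ∘ η with hγ
  have hη : ∀ t ∈ Icc (0 : ℝ) 1, η t ∈ ball (extChartAt I x x) r ∩ range I := by
    change Icc (0 : ℝ) 1 ⊆ η ⁻¹' (ball (extChartAt I x x) r ∩ range I)
    simp only [← image_subset_iff, ContinuousAffineMap.coe_lineMap_eq,
     ← segment_eq_image_lineMap, η]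
    exact ((convex_ball _ _).inter I.convex_range).segment_subset hp hq
  have η_smooth : CMDiff[Icc 0 1] 1 η := by
    apply ContMDiff.contMDiffOn
    rw [contMDiff_iff_contDiff]
    exact ContinuousAffineMap.contDiff _
  rw [IsRiemannianManifold.out (I := I)]
  have : riemannianEDist I ((extChartAt I x).symm p) ((extChartAt I x).symm q)
      ≤ pathELength I γ 0 1 := by
    apply riemannianEDist_le_pathELength _ _ _ zero_le_one
    · exact (contMDiffOn_extChartAt_symm x).comp η_smooth fun t ht => (hr (hη t ht)).1
    · simp [γ, η, ContinuousAffineMap.coe_lineMap_eq]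
    · simp [γ, η, ContinuousAffineMap.coe_lineMap_eq]
  apply this.trans
  rw [← lintegral_fderiv_lineMap_eq_edist, pathELength_eq_lintegral_mfderivWithin_Icc,
    ← lintegral_const_mul' _ _ ENNReal.coe_ne_top]
  apply setLIntegral_mono' measurableSet_Icc (fun t ht ↦ ?_)
  have : mfderiv[Icc 0 1] γ t =
      (mfderiv[range I] (extChartAt I x).symm (η t)) ∘L (mfderiv[Icc 0 1] η t) := by
    apply mfderivWithin_comp
    · exact mdifferentiableWithinAt_extChartAt_symm (hr (hη t ht)).1
    · exact η_smooth.mdifferentiableOn one_ne_zero t ht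
    · exact fun s hs => (hη s hs).2
    · rw [uniqueMDiffWithinAt_iff_uniqueDiffWithinAt]
      exact uniqueDiffOn_Icc zero_lt_one t ht
  have : mfderiv[Icc 0 1] γ t 1 =
      (mfderiv[range I] (extChartAt I x).symm (η t)) (mfderiv[Icc 0 1] η t 1) := congr($this 1)
  rw [this, mfderivWithin_eq_fderivWithin]
  exact (hr (hη t ht)).2 _

/-- An extended chart is locally Lipschitz for the Riemannian distance. -/
theorem exists_lipschitzOnWith_extChartAt (x : M) :
    ∃ C > (0 : ℝ≥0), ∃ c > (0 : ℝ≥0∞), eball x c ⊆ (extChartAt I x).source ∧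
      LipschitzOnWith C (extChartAt I x) (eball x c) := by
  rcases eventually_enorm_mfderiv_extChartAt_apply_le I x with ⟨C, C_pos, hC⟩
  obtain ⟨c, c_pos, hc⟩ := EMetric.mem_nhds_iff.1
    (Filter.inter_mem hC (extChartAt_source_mem_nhds (I := I) x))
  have hs : ∀ y ∈ eball x c, y ∈ (chartAt H x).source := fun y hy => by
    simpa only [extChartAt_source] using (hc hy).2
  have c2 : c / 2 / 2 + c / 2 / 2 = c / 2 := ENNReal.add_halves _
  have c1 : c / 2 + c / 2 = c := ENNReal.add_halves _
  have c42 : c / 2 / 2 ≤ c / 2 := ENNReal.half_le_self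
  -- Points of the quarter ball are less than `c / 2` apart, and a path of length below `c / 2`
  -- starting there stays in `eball x c`, where the derivative bound holds.
  refine ⟨C, C_pos, c / 2 / 2, ENNReal.half_pos (ENNReal.half_pos c_pos.ne').ne', ?_, ?_⟩
  · intro y hy
    refine (hc ?_).2
    exact eball_subset_eball (c42.trans ENNReal.half_le_self) hy
  intro y hy z hz
  have C0 : (C : ℝ≥0∞) ≠ 0 := by simpa using C_pos.ne'
  -- The Riemannian distance is an infimum that need not be attained, so the path used is only
  -- almost minimal.
  refine le_of_forall_gt_imp_ge_of_dense fun b hb => ?_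
  have hyz : edist y z < b / C := by
    rw [ENNReal.lt_div_iff_mul_lt (Or.inl C0) (Or.inl ENNReal.coe_ne_top), mul_comm]
    exact hb
  have hyz' : edist y z < c / 2 := by
    rw [← c2]
    refine (edist_triangle y x z).trans_lt (ENNReal.add_lt_add hy ?_)
    simpa [edist_comm] using hz
  have hlt : riemannianEDist I y z < min (b / C) (c / 2) := by
    rw [← IsRiemannianManifold.out (I := I) y z]
    exact lt_min hyz hyz'
  rcases exists_lt_locally_constant_of_riemannianEDist_lt hlt zero_lt_one
    with ⟨γ, hγy, hγz, γ_smooth, hγ, -⟩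
  have hmem : ∀ t ∈ Icc (0 : ℝ) 1, γ t ∈ eball x c := by
    intro t ht
    have h1 : edist y (γ t) < c / 2 := by
      rw [IsRiemannianManifold.out (I := I) y (γ t)]
      calc riemannianEDist I y (γ t) ≤ pathELength I γ 0 t :=
            riemannianEDist_le_pathELength γ_smooth.contMDiffOn hγy rfl ht.1
        _ ≤ pathELength I γ 0 1 := pathELength_mono le_rfl ht.2
        _ < c / 2 := hγ.trans_le (min_le_right _ _)
    rw [mem_eball', ← c1]
    refine (edist_triangle x y (γ t)).trans_lt (ENNReal.add_lt_add ?_ h1)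
    exact lt_of_lt_of_le (by simpa [edist_comm] using hy) c42
  let γ' := extChartAt I x ∘ γ
  have hC' : CMDiff[Icc 0 1] 1 γ' :=
    contMDiffOn_extChartAt.comp (I' := I) (t := (chartAt H x).source)
      γ_smooth.contMDiffOn (fun t' ht' ↦ hs _ (hmem _ ht'))
  have key : ‖γ' 1 - γ' 0‖ₑ ≤ b := by
    calc
      ‖γ' 1 - γ' 0‖ₑ
    _ ≤ ∫⁻ t' in Icc (0 : ℝ) 1, ‖derivWithin γ' (Icc 0 1) t'‖ₑ := by
      apply enorm_sub_le_lintegral_derivWithin_Icc_of_contDiffOn_Icc _ zero_le_one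
      rwa [← contMDiffOn_iff_contDiffOn]
    _ ≤ ∫⁻ t' in Icc (0 : ℝ) 1, C * ‖mfderiv[Icc 0 1] γ t' 1‖ₑ := by
      apply setLIntegral_mono' measurableSet_Icc (fun t' ht' ↦ ?_)
      have : mfderiv[Icc 0 1] γ' t' =
          (mfderiv% (extChartAt I x) (γ t')) ∘L (mfderiv[Icc 0 1] γ t') := by
        apply mfderiv_comp_mfderivWithin
        · exact mdifferentiableAt_extChartAt (hs _ (hmem _ ht'))
        · exact (γ_smooth.mdifferentiable one_ne_zero).mdifferentiableOn _ ht'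
        · rw [uniqueMDiffWithinAt_iff_uniqueDiffWithinAt]
          exact uniqueDiffOn_Icc zero_lt_one _ ht'
      have hd : derivWithin γ' (Icc 0 1) t' =
          (show E from mfderiv% (extChartAt I x) (γ t') (mfderiv[Icc 0 1] γ t' 1)) := by
        rw [← fderivWithin_derivWithin, ← mfderivWithin_eq_fderivWithin]
        exact congr($this 1)
      rw [hd]
      exact (hc (hmem _ ht')).1 _
    _ = C * pathELength I γ 0 1 := by
      rw [lintegral_const_mul' _ _ ENNReal.coe_ne_top,
          pathELength_eq_lintegral_mfderivWithin_Icc]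
    _ ≤ C * (b / C) := by
      gcongr
      exact hγ.le.trans (min_le_left _ _)
    _ = b := ENNReal.mul_div_cancel C0 ENNReal.coe_ne_top
  rw [edist_comm, edist_eq_enorm_sub]
  simpa [γ', hγy, hγz] using key

end ChartLipschitz

/-! ### Volume of small balls. -/

section VolumeBounds

open Set Metric MeasureTheory Measure
open scoped NNReal

/-- The factor between `μHE[d]` and `μH[d]` depends only on `d`, so it is the same in both spaces.
-/
theorem LipschitzOnWith.euclideanHausdorffMeasure_image_le {X Y : Type*}
    [EMetricSpace X] [MeasurableSpace X] [BorelSpace X]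
    [EMetricSpace Y] [MeasurableSpace Y] [BorelSpace Y] {K : ℝ≥0} {f : X → Y} {s : Set X}
    (h : LipschitzOnWith K f s) (d : ℕ) :
    μHE[d] (f '' s) ≤ (K : ℝ≥0∞) ^ d * μHE[d] s := by
  have := h.hausdorffMeasure_image_le (d := d) (Nat.cast_nonneg d)
  rw [ENNReal.rpow_natCast] at this
  simp only [euclideanHausdorffMeasure_def, Measure.smul_apply, ENNReal.smul_def, smul_eq_mul]
  calc _ ≤ _ := mul_le_mul_right this _
    _ = _ := by ring

/-- Shifting the center by `s / 2` into the half-space leaves room for a full ball of radius `s /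
4`. -/
theorem volume_ball_le_volume_ball_inter_halfSpace {d : ℕ} [NeZero d]
    {p : EuclideanSpace ℝ (Fin d)} (hp : 0 ≤ p 0) {s : ℝ} (hs : 0 < s) :
    volume (ball (0 : EuclideanSpace ℝ (Fin d)) (s / 4)) ≤
      volume (ball p s ∩ {y : EuclideanSpace ℝ (Fin d) | 0 ≤ y 0}) := by
  set q : EuclideanSpace ℝ (Fin d) := p + EuclideanSpace.single 0 (s / 2) with hq
  have hq0 : q 0 = p 0 + s / 2 := by simp [hq]
  have hqp : dist q p = s / 2 := by
    rw [hq, dist_eq_norm, add_sub_cancel_left, PiLp.norm_single, Real.norm_eq_abs,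
      abs_of_pos (by positivity)]
  rw [← addHaar_ball_center volume q]
  refine measure_mono fun y hy => ⟨?_, ?_⟩
  · rw [mem_ball] at hy ⊢
    linarith [dist_triangle y q p]
  · have h1 : ‖(y - q) 0‖ ≤ ‖y - q‖ := PiLp.norm_apply_le _ _
    rw [mem_ball, dist_eq_norm] at hy
    have h2 := (abs_le.1 (Real.norm_eq_abs _ ▸ h1)).1
    simp only [PiLp.sub_apply, hq0] at h2
    simp only [mem_ofPred_eq]
    linarith

variable (d : ℕ) [NeZero d]
    {M : Type*} [EMetricSpace M] [MeasurableSpace M] [BorelSpace M]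
    [ChartedSpace (EuclideanHalfSpace d) M] [IsManifold (𝓡∂ d) 1 M]
    [Bundle.RiemannianBundle (fun x : M => TangentSpace (𝓡∂ d) x)]
    [IsContinuousRiemannianBundle (EuclideanSpace ℝ (Fin d))
      (fun x : M => TangentSpace (𝓡∂ d) x)]
    [IsRiemannianManifold (𝓡∂ d) M]

/-- Locally uniform Ahlfors regularity of the volume of a Riemannian manifold with boundary. -/
theorem exists_forall_eball_volume_bounds (x₀ : M) :
    ∃ a > (0 : ℝ≥0), ∃ b : ℝ≥0, ∃ δ > (0 : ℝ≥0), ∀ x ∈ eball x₀ δ, ∀ r : ℝ≥0, 0 < r → r < δ →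
      (a * r ^ d : ℝ≥0∞) ≤ μHE[d] (eball x (r : ℝ≥0∞)) ∧
      μHE[d] (eball x (r : ℝ≥0∞)) ≤ (b * r ^ d : ℝ≥0∞) := by
  obtain ⟨C₁, hC₁, ρ, hρ, htarget, hlip₁⟩ := exists_lipschitzOnWith_extChartAt_symm (𝓡∂ d) x₀
  obtain ⟨C₂, hC₂, c, hc, hsource, hlip₂⟩ := exists_lipschitzOnWith_extChartAt (𝓡∂ d) x₀
  lift ρ to ℝ≥0 using hρ.le
  replace hρ : 0 < ρ := by exact_mod_cast hρ
  obtain ⟨q, hq, hqc⟩ : ∃ q : ℝ≥0, 0 < q ∧ (q : ℝ≥0∞) ≤ c := by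
    obtain ⟨q, h0, h1⟩ := ENNReal.lt_iff_exists_nnreal_btwn.1 hc
    exact ⟨q, by exact_mod_cast h0, h1.le⟩
  set φ := extChartAt (𝓡∂ d) x₀ with hφ
  set κ := volume (ball (0 : EuclideanSpace ℝ (Fin d)) 1) with hκ
  have hκ0 : κ ≠ 0 := (measure_ball_pos _ _ one_pos).ne'
  have hκt : κ ≠ ⊤ := measure_ball_lt_top.ne
  have hvol : ∀ (p : EuclideanSpace ℝ (Fin d)) (s : ℝ≥0), 0 < s →
      volume (ball p (s : ℝ)) = s ^ d * κ := by
    intro p s hs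
    rw [addHaar_ball _ _ s.coe_nonneg, finrank_euclideanSpace_fin,
      ENNReal.ofReal_pow s.coe_nonneg, ENNReal.ofReal_coe_nnreal]
  obtain ⟨w, hw⟩ : ∃ w : ℝ≥0, (w : ℝ≥0∞) = κ := ⟨κ.toNNReal, ENNReal.coe_toNNReal hκt⟩
  have hw0 : 0 < w := by
    rw [pos_iff_ne_zero]; rintro rfl; exact hκ0 (by simpa using hw.symm)
  -- The three terms keep the small balls where the chart is Lipschitz, their images in the ball of
  -- radius `ρ` where the inverse is Lipschitz, and the coordinate radius `r / C₁` below `ρ / 2`.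
  set δ : ℝ≥0 := min (q / 2) (min (ρ / (2 * C₂)) (ρ * C₁ / 2)) with hδ
  have hδ1 : δ + δ ≤ q := by
    have : δ ≤ q / 2 := min_le_left _ _
    calc δ + δ ≤ q / 2 + q / 2 := add_le_add this this
      _ = q := add_halves q
  have hδ2 : C₂ * δ ≤ ρ / 2 := by
    have : δ ≤ ρ / (2 * C₂) := (min_le_right _ _).trans (min_le_left _ _)
    calc C₂ * δ ≤ C₂ * (ρ / (2 * C₂)) := by gcongr
      _ = ρ / 2 := by field_simp
  have hδ3 : δ / C₁ ≤ ρ / 2 := by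
    have : δ ≤ ρ * C₁ / 2 := (min_le_right _ _).trans (min_le_right _ _)
    calc δ / C₁ ≤ (ρ * C₁ / 2) / C₁ := by gcongr
      _ = ρ / 2 := by field_simp
  -- Lower bound: the ball contains the image of a half-space ball of radius `r / C₁`; the factors
  -- `4` and `C₂` come from the half-space and from the chart. Upper bound: the ball lies in the
  -- image of a ball of radius `C₂ * r`.
  refine ⟨w / (4 * C₁ * C₂) ^ d, by positivity, (C₁ * C₂) ^ d * w, δ, by positivity, ?_⟩
  intro x hx r hr hrδ
  have hball : ∀ y ∈ eball x (r : ℝ≥0∞), edist y x₀ < ((δ + δ : ℝ≥0) : ℝ≥0∞) := by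
    intro y hy
    push_cast
    refine (edist_triangle y x x₀).trans_lt (ENNReal.add_lt_add (lt_trans hy ?_) hx)
    exact_mod_cast hrδ
  have hball' : eball x (r : ℝ≥0∞) ⊆ eball x₀ c := fun y hy =>
    (hball y hy).trans_le (le_trans (by exact_mod_cast hδ1) hqc)
  have hx0 : x₀ ∈ eball x₀ c := mem_eball_self hc
  have hxr : x ∈ eball x (r : ℝ≥0∞) := mem_eball_self (by exact_mod_cast hr)
  have hxc : x ∈ eball x₀ c := hball' hxr
  have hrange : ∀ y ∈ eball x₀ c, φ y ∈ range (𝓡∂ d) := fun y hy =>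
    extChartAt_target_subset_range x₀ (φ.map_source (hsource hy))
  have hφball : ∀ y ∈ eball x (r : ℝ≥0∞), φ y ∈ ball (φ x₀) ρ := by
    intro y hy
    rw [← eball_coe, mem_eball]
    calc edist (φ y) (φ x₀) ≤ C₂ * edist y x₀ := hlip₂ (hball' hy) hx0
      _ < C₂ * ((δ + δ : ℝ≥0) : ℝ≥0∞) :=
        ENNReal.mul_lt_mul_right (by simpa using hC₂.ne') ENNReal.coe_ne_top (hball y hy)
      _ ≤ ρ := by
        rw [← ENNReal.coe_mul, ENNReal.coe_le_coe, mul_add]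
        calc _ ≤ ρ / 2 + ρ / 2 := add_le_add hδ2 hδ2
          _ = ρ := add_halves ρ
  have hleft : ∀ y ∈ eball x₀ c, φ.symm (φ y) = y := fun y hy => φ.left_inv (hsource hy)
  constructor
  · set s : ℝ≥0 := r / C₁ with hs
    have hs0 : 0 < s := by positivity
    set S := ball (φ x) (s : ℝ) ∩ range (𝓡∂ d) with hS
    have hSB : S ⊆ ball (φ x₀) ρ ∩ range (𝓡∂ d) := by
      rintro p ⟨hp, hp'⟩
      refine ⟨?_, hp'⟩
      rw [← eball_coe, mem_eball] at hp ⊢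
      have h1 : edist (φ x) (φ x₀) ≤ (ρ / 2 : ℝ≥0) :=
        calc edist (φ x) (φ x₀) ≤ C₂ * edist x x₀ := hlip₂ hxc hx0
          _ ≤ C₂ * (δ : ℝ≥0∞) := mul_le_mul_right (le_of_lt hx) _
          _ ≤ _ := by exact_mod_cast hδ2
      have h2 : (s : ℝ≥0∞) ≤ (ρ / 2 : ℝ≥0) := by
        rw [ENNReal.coe_le_coe]
        refine le_trans ?_ hδ3
        rw [hs]; gcongr
      calc edist p (φ x₀) ≤ edist p (φ x) + edist (φ x) (φ x₀) := edist_triangle _ _ _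
        _ < (ρ / 2 : ℝ≥0) + (ρ / 2 : ℝ≥0) :=
          ENNReal.add_lt_add_of_lt_of_le (h1.trans_lt ENNReal.coe_lt_top).ne
            (hp.trans_le h2) h1
        _ = ρ := by rw [← ENNReal.coe_add, add_halves]
    have hsub : φ.symm '' S ⊆ eball x (r : ℝ≥0∞) := by
      rintro _ ⟨p, hp, rfl⟩
      rw [mem_eball]
      calc edist (φ.symm p) x = edist (φ.symm p) (φ.symm (φ x)) := by rw [hleft x hxc]
        _ ≤ C₁ * edist p (φ x) := hlip₁ (hSB hp) ⟨hφball x hxr, hrange x hxc⟩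
        _ < C₁ * s := by
          refine ENNReal.mul_lt_mul_right (by simpa using hC₁.ne') ENNReal.coe_ne_top ?_
          have := hp.1
          rwa [← eball_coe, mem_eball] at this
        _ = r := by rw [← ENNReal.coe_mul, hs]; congr 1; field_simp
    have hSimg : S ⊆ φ '' (φ.symm '' S) := by
      intro p hp
      exact ⟨φ.symm p, ⟨p, hp, rfl⟩, φ.right_inv (htarget (hSB hp))⟩
    have h1 : volume S ≤ (C₂ : ℝ≥0∞) ^ d * μHE[d] (eball x (r : ℝ≥0∞)) :=
      calc volume S = μHE[d] S := by rw [EuclideanSpace.euclideanHausdorffMeasure_eq_volume]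
        _ ≤ μHE[d] (φ '' (φ.symm '' S)) := measure_mono hSimg
        _ ≤ (C₂ : ℝ≥0∞) ^ d * μHE[d] (φ.symm '' S) :=
          (hlip₂.mono (hsub.trans hball')).euclideanHausdorffMeasure_image_le d
        _ ≤ _ := mul_le_mul_right (measure_mono hsub) _
    have h2 : ((s / 4 : ℝ≥0) : ℝ≥0∞) ^ d * κ ≤ volume S := by
      rw [← hvol 0 (s / 4) (by positivity), hS, range_modelWithCornersEuclideanHalfSpace]
      have hp : 0 ≤ (φ x) 0 := by
        have := hrange x hxc
        rwa [range_modelWithCornersEuclideanHalfSpace] at this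
      simpa using volume_ball_le_volume_ball_inter_halfSpace hp (NNReal.coe_pos.2 hs0)
    have h3 := h2.trans h1
    have hC2d : ((C₂ : ℝ≥0∞) ^ d) ≠ 0 := pow_ne_zero _ (by simpa using hC₂.ne')
    rw [← ENNReal.mul_le_mul_iff_right hC2d (ENNReal.pow_ne_top ENNReal.coe_ne_top)]
    refine le_trans (le_of_eq ?_) h3
    rw [← hw]
    norm_cast
    rw [hs]
    field_simp
    rw [← mul_pow, ← mul_pow]
    congr 1
    field_simp
  · have hsub : eball x (r : ℝ≥0∞) ⊆ φ.symm '' (ball (φ x) (C₂ * r) ∩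
        (ball (φ x₀) ρ ∩ range (𝓡∂ d))) := by
      intro y hy
      refine ⟨φ y, ⟨?_, hφball y hy, hrange y (hball' hy)⟩, hleft y (hball' hy)⟩
      rw [← NNReal.coe_mul, ← eball_coe, mem_eball]
      calc edist (φ y) (φ x) ≤ C₂ * edist y x := hlip₂ (hball' hy) hxc
        _ < C₂ * r :=
          ENNReal.mul_lt_mul_right (by simpa using hC₂.ne') ENNReal.coe_ne_top hy
        _ = _ := by push_cast; rfl
    calc μHE[d] (eball x (r : ℝ≥0∞)) ≤ _ := measure_mono hsub
      _ ≤ (C₁ : ℝ≥0∞) ^ d * _ :=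
        (hlip₁.mono inter_subset_right).euclideanHausdorffMeasure_image_le d
      _ ≤ (C₁ : ℝ≥0∞) ^ d * μHE[d] (ball (φ x) (C₂ * r)) :=
        mul_le_mul_right (measure_mono inter_subset_left) _
      _ = (C₁ : ℝ≥0∞) ^ d * ((C₂ * r : ℝ≥0) ^ d * κ) := by
        rw [EuclideanSpace.euclideanHausdorffMeasure_eq_volume, ← NNReal.coe_mul,
          hvol _ _ (by positivity)]
      _ = _ := by
        rw [← hw]
        push_cast
        ring

/-- On a compact Riemannian manifold with boundary, small balls have volume comparable with the
`d`-th power of their radius. -/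
theorem exists_eball_volume_bounds [CompactSpace M] :
    ∃ a > (0 : ℝ≥0), ∃ b : ℝ≥0, ∃ δ > (0 : ℝ≥0), ∀ x : M, ∀ r : ℝ≥0, 0 < r → r < δ →
      (a * r ^ d : ℝ≥0∞) ≤ μHE[d] (eball x (r : ℝ≥0∞)) ∧
      μHE[d] (eball x (r : ℝ≥0∞)) ≤ (b * r ^ d : ℝ≥0∞) := by
  choose a ha b δ hδ h using exists_forall_eball_volume_bounds d (M := M)
  obtain ⟨t, ht⟩ := CompactSpace.elim_nhds_subcover (fun x : M => eball x (δ x : ℝ≥0∞))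
    fun x => eball_mem_nhds x (by exact_mod_cast hδ x)
  have hmem : ∀ x : M, ∃ y ∈ t, x ∈ eball y (δ y : ℝ≥0∞) := fun x => by
    simpa using (ht ▸ mem_univ x : x ∈ ⋃ y ∈ t, eball y (δ y : ℝ≥0∞))
  rcases t.eq_empty_or_nonempty with rfl | hne
  -- An empty cover means that `M` is empty, so any constants do.
  · exact ⟨1, one_pos, 1, 1, one_pos, fun x => by simpa using hmem x⟩
  refine ⟨t.inf' hne a, (Finset.lt_inf'_iff hne).2 fun y _ => ha y, t.sup' hne b,
    t.inf' hne δ, (Finset.lt_inf'_iff hne).2 fun y _ => hδ y, fun x r hr hrδ => ?_⟩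
  obtain ⟨y, hyt, hy⟩ := hmem x
  obtain ⟨h1, h2⟩ := h y x hy r hr (hrδ.trans_le (Finset.inf'_le _ hyt))
  constructor
  · refine le_trans ?_ h1
    gcongr
    exact Finset.inf'_le _ hyt
  · refine h2.trans ?_
    gcongr
    exact Finset.le_sup' _ hyt

end VolumeBounds

/-! ### From an upper density bound to an inequality of measures. -/

section Density

open Set Metric MeasureTheory Measure Filter
open scoped NNReal

/-- An outer measure for which small balls around the points of `s` satisfy
`m (s ∩ B(x, r)) ≤ C r ^ k` vanishes on `s` if the `k`-dimensional Hausdorff measure does. -/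
theorem MeasureTheory.OuterMeasure.eq_zero_of_hausdorffMeasure_eq_zero {X : Type*} [EMetricSpace X]
    [MeasurableSpace X] [BorelSpace X] (m : OuterMeasure X) {s : Set X} {k : ℕ} {C δ : ℝ≥0}
    (hδ : 0 < δ)
    (h : ∀ x ∈ s, ∀ r : ℝ≥0, 0 < r → r < δ → m (s ∩ eball x (r : ℝ≥0∞)) ≤ C * r ^ k)
    (hs : (μH[k] : Measure X) s = 0) : m s = 0 := by
  have hC : ((C + 1 : ℝ≥0) : ℝ≥0∞) ≠ 0 := by simp
  -- The comparison need only be checked on sets of small diameter. Using `C + 1` keeps the inverse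
  -- finite when `C = 0`.
  have key : ((C + 1 : ℝ≥0) : ℝ≥0∞)⁻¹ • OuterMeasure.restrict s m ≤
      OuterMeasure.mkMetric fun r => r ^ (k : ℝ) := by
    have hδ2 : (0 : ℝ≥0∞) < ((δ / 2 : ℝ≥0) : ℝ≥0∞) := by exact_mod_cast half_pos hδ
    refine OuterMeasure.le_mkMetric _ _ _ hδ2 fun t ht => ?_
    rw [_root_.smul_apply, OuterMeasure.restrict_apply, smul_eq_mul, ENNReal.rpow_natCast]
    rcases (t ∩ s).eq_empty_or_nonempty with h0 | ⟨x, hxt, hxs⟩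
    · simp [h0]
    obtain ⟨D, hD⟩ : ∃ D : ℝ≥0, (D : ℝ≥0∞) = ediam t :=
      ⟨(ediam t).toNNReal, ENNReal.coe_toNNReal (ht.trans_lt ENNReal.coe_lt_top).ne⟩
    rw [← hD] at ht ⊢
    have hDδ : D < δ := lt_of_le_of_lt (by exact_mod_cast ht) (half_lt_self hδ)
    have hle : ∀ r : ℝ≥0, D < r → r < δ → m (t ∩ s) ≤ C * r ^ k := fun r hr hrδ => by
      refine (m.mono ?_).trans (h x hxs r (zero_le.trans_lt hr) hrδ)
      rintro y ⟨hyt, hys⟩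
      refine ⟨hys, (edist_le_ediam_of_mem hyt hxt).trans_lt ?_⟩
      rw [← hD]
      exact_mod_cast hr
    -- A set of diameter `D` is caught by open balls of every radius above `D`; let the radius
    -- decrease to `D`.
    have hlim : Tendsto (fun r : ℝ≥0 => ((C * r ^ k : ℝ≥0) : ℝ≥0∞)) (𝓝[>] D)
        (𝓝 ((C * D ^ k : ℝ≥0) : ℝ≥0∞)) := by
      refine ENNReal.tendsto_coe.2 (Tendsto.mono_left ?_ nhdsWithin_le_nhds)
      exact ((continuous_const.mul (continuous_id.pow k)).tendsto D)
    have hmle : m (t ∩ s) ≤ ((C * D ^ k : ℝ≥0) : ℝ≥0∞) := by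
      refine ge_of_tendsto hlim ?_
      filter_upwards [Ioo_mem_nhdsGT hDδ] with r hr
      push_cast
      exact hle r hr.1 hr.2
    rw [mul_comm, ← div_eq_mul_inv]
    refine ENNReal.div_le_of_le_mul (hmle.trans ?_)
    rw [mul_comm]
    push_cast
    gcongr
    exact le_self_add
  have hz := key s
  rw [OuterMeasure.coe_mkMetric, _root_.smul_apply, OuterMeasure.restrict_apply, inter_self,
    smul_eq_mul] at hz
  have h0 : ((C + 1 : ℝ≥0) : ℝ≥0∞)⁻¹ * m s = 0 := le_antisymm (hz.trans hs.le) zero_le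
  exact (mul_eq_zero.1 h0).resolve_left (by simp)

/-- A measure with `μ (B(x, r)) = O(r ^ k)` at every point is absolutely continuous with respect to
the `k`-dimensional Hausdorff measure. -/
theorem MeasureTheory.Measure.absolutelyContinuous_hausdorffMeasure {X : Type*} [EMetricSpace X]
    [MeasurableSpace X] [BorelSpace X] {μ : Measure X} {k : ℕ} {C : ℝ≥0}
    (h : ∀ x, ∃ δ > (0 : ℝ≥0), ∀ r : ℝ≥0, 0 < r → r < δ →
      μ (eball x (r : ℝ≥0∞)) ≤ C * r ^ k) : μ ≪ μH[k] := by
  intro s hs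
  -- On each piece the admissible radii are uniform. The pieces need not be measurable, which is
  -- harmless for outer measures.
  let t : ℕ → Set X := fun n => {x ∈ s | ∀ r : ℝ≥0, 0 < r → r < 1 / ((n : ℝ≥0) + 1) →
    μ (eball x (r : ℝ≥0∞)) ≤ C * r ^ k}
  have hst : s ⊆ ⋃ n, t n := by
    intro x hx
    obtain ⟨δ, hδ, hx'⟩ := h x
    obtain ⟨n, hn⟩ := exists_nat_one_div_lt hδ
    exact mem_iUnion.2 ⟨n, hx, fun r hr hrn => hx' r hr (hrn.trans hn)⟩
  refine measure_mono_null hst (measure_iUnion_null fun n => ?_)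
  refine μ.toOuterMeasure.eq_zero_of_hausdorffMeasure_eq_zero (k := k) (C := C)
    (δ := 1 / ((n : ℝ≥0) + 1)) (by positivity) (fun x hx r hr hrn => ?_)
    (measure_mono_null (fun x hx => hx.1) hs)
  exact (measure_mono inter_subset_right).trans (hx.2 r hr hrn)

/-- Comparison of measures on closed balls at every point, at arbitrarily small scales, implies
comparison of measures, if the larger one is doubling and controls the null sets. -/
theorem MeasureTheory.Measure.le_of_closedBall_le_of_doubling {X : Type*} [PseudoMetricSpace X]
    [SecondCountableTopology X] [MeasurableSpace X] [BorelSpace X] {μ ν : Measure X}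
    [IsLocallyFiniteMeasure ν] (hμν : μ ≪ ν) {C : ℝ≥0} {δ : ℝ} (hδ : 0 < δ)
    (hν : ∀ x, ∀ r, 0 < r → r < δ → ν (closedBall x (3 * r)) ≤ C * ν (closedBall x r))
    {c : ℝ≥0} (h : ∀ x, ∀ᶠ r in 𝓝[>] 0, μ (closedBall x r) ≤ c * ν (closedBall x r)) :
    μ ≤ c • ν := by
  have hfreq : ∀ x, ∃ᶠ r in 𝓝[>] (0 : ℝ), ν (closedBall x (3 * r)) ≤ C * ν (closedBall x r) := by
    intro x
    refine Eventually.frequently ?_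
    filter_upwards [Ioo_mem_nhdsGT hδ] with r hr using hν x r hr.1 hr.2
  refine Measure.le_intro fun s _ _ => ?_
  refine (Vitali.vitaliFamily ν C hfreq).measure_le_of_frequently_le (c • ν) hμν s fun x _ => ?_
  rw [VitaliFamily.frequently_filterAt_iff]
  intro ε hε
  obtain ⟨r, hr, hrδ, hrε⟩ := ((h x).and (Ioo_mem_nhdsGT (lt_min hδ hε))).exists
  refine ⟨closedBall x r, ⟨isClosed_closedBall, ?_, r, Subset.rfl, hν x r hrδ
    (hrε.trans_le (min_le_left _ _))⟩, closedBall_subset_closedBall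
    (hrε.le.trans (min_le_right _ _)), hr⟩
  exact (nonempty_ball.2 hrδ).mono ball_subset_interior_closedBall

/-- The metric `min (edist x y) 1`, with the uniformity that it defines. -/
noncomputable abbrev PseudoEMetricSpace.truncateCore (X : Type*) [PseudoEMetricSpace X] :
    PseudoMetricSpace X where
  dist x y := (min (edist x y) 1).toReal
  dist_self x := by simp
  dist_comm x y := by rw [edist_comm]
  dist_triangle x y z := by
    have hne : ∀ a : ℝ≥0∞, min a 1 ≠ ⊤ := fun a =>
      ((min_le_right a 1).trans_lt ENNReal.one_lt_top).ne
    rw [← ENNReal.toReal_add (hne _) (hne _)]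
    refine ENNReal.toReal_mono (ENNReal.add_ne_top.2 ⟨hne _, hne _⟩) ?_
    rcases le_total 1 (edist x y) with h1 | h1
    · rw [min_eq_right h1]
      exact (min_le_right _ _).trans le_self_add
    rcases le_total 1 (edist y z) with h2 | h2
    · rw [min_eq_right h2]
      exact (min_le_right _ _).trans le_add_self
    rw [min_eq_left h1, min_eq_left h2]
    exact (min_le_left _ _).trans (edist_triangle x y z)

/-- Distances in `M` may be infinite, while the Vitali argument uses a real-valued metric.
Truncation at `1` leaves balls of radius below `1` unchanged. -/
theorem PseudoEMetricSpace.truncateCore_topology (X : Type*) [hX : PseudoEMetricSpace X] :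
    hX.toUniformSpace.toTopologicalSpace =
      (PseudoEMetricSpace.truncateCore X).toUniformSpace.toTopologicalSpace := by
  refine TopologicalSpace.ext_nhds fun x => ?_
  have hiff : ∀ r : ℝ, r < 1 → ∀ y, (min (edist y x) 1).toReal < r ↔
      edist y x < ENNReal.ofReal r := by
    intro r hr1 y
    rw [← ENNReal.lt_ofReal_iff_toReal_lt
      ((min_le_right _ _).trans_lt ENNReal.one_lt_top).ne, min_lt_iff, or_iff_left]
    rw [not_lt, ENNReal.ofReal_le_one]
    exact hr1.le
  refine (@Metric.nhds_basis_eball X hX x).ext (@Metric.nhds_basis_ball X (truncateCore X) x) ?_ ?_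
  · intro ε hε
    obtain ⟨r, h0, h1⟩ := ENNReal.lt_iff_exists_nnreal_btwn.1 (lt_min hε one_pos)
    have hr0 : (0 : ℝ) < r := by exact_mod_cast h0
    have hr1 : (r : ℝ) < 1 := by exact_mod_cast h1.trans_le (min_le_right _ _)
    refine ⟨r, hr0, fun y hy => ?_⟩
    have := (hiff r hr1 y).1 hy
    rw [ENNReal.ofReal_coe_nnreal] at this
    exact this.trans (h1.trans_le (min_le_left _ _))
  · intro ε hε
    refine ⟨ENNReal.ofReal (min ε (1 / 2)), by simpa using hε, fun y hy => ?_⟩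
    exact ((hiff _ ((min_le_right _ _).trans_lt (by norm_num)) y).2 hy).trans_le (min_le_left _ _)

/-- The metric `min (edist x y) 1`, which has the same topology and the same small balls as the
given extended metric. -/
noncomputable abbrev PseudoEMetricSpace.truncate (X : Type*) [PseudoEMetricSpace X] :
    PseudoMetricSpace X :=
  (PseudoEMetricSpace.truncateCore X).replaceTopology (PseudoEMetricSpace.truncateCore_topology X)

theorem PseudoEMetricSpace.closedBall_truncate {X : Type*} [PseudoEMetricSpace X] (x : X) {r : ℝ}
    (hr0 : 0 ≤ r) (hr1 : r < 1) :
    @closedBall X (PseudoEMetricSpace.truncate X) x r = closedEBall x (ENNReal.ofReal r) := by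
  ext y
  change (min (edist y x) 1).toReal ≤ r ↔ edist y x ≤ ENNReal.ofReal r
  rw [← ENNReal.le_ofReal_iff_toReal_le ((min_le_right _ _).trans_lt ENNReal.one_lt_top).ne hr0,
    min_le_iff, or_iff_left]
  rwa [not_le, ENNReal.ofReal_lt_one]

/-- In an Ahlfors regular compact space, a measure whose upper density with respect to the volume
is everywhere at most `1` is bounded by the volume. -/
theorem MeasureTheory.Measure.le_of_limsup_eball_le_one {X : Type*} [EMetricSpace X]
    [CompactSpace X] [MeasurableSpace X] [BorelSpace X] {μ ν : Measure X} {d : ℕ}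
    (hνd : (μH[d] : Measure X) ≪ ν) {a b δ : ℝ≥0} (ha : 0 < a) (hδ : 0 < δ)
    (hν : ∀ x : X, ∀ r : ℝ≥0, 0 < r → r < δ →
      (a * r ^ d : ℝ≥0∞) ≤ ν (eball x (r : ℝ≥0∞)) ∧ ν (eball x (r : ℝ≥0∞)) ≤ (b * r ^ d : ℝ≥0∞))
    (h : ∀ x, limsup (fun r : ℝ≥0∞ => μ (eball x r) / ν (eball x r)) (𝓝[>] 0) ≤ 1) :
    μ ≤ ν := by
  have hpos : ∀ (x : X) (r : ℝ≥0∞), 0 < r → r < δ → ν (eball x r) ≠ 0 ∧ ν (eball x r) ≠ ⊤ := by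
    intro x r hr hrδ
    lift r to ℝ≥0 using (hrδ.trans ENNReal.coe_lt_top).ne
    obtain ⟨h1, h2⟩ := hν x r (by exact_mod_cast hr) (by exact_mod_cast hrδ)
    refine ⟨((ENNReal.mul_pos ?_ (pow_ne_zero _ hr.ne')).trans_le h1).ne', (h2.trans_lt ?_).ne⟩
    · exact_mod_cast ha.ne'
    · exact_mod_cast ENNReal.coe_lt_top
  have hloc : IsLocallyFiniteMeasure ν := by
    refine ⟨fun x => ⟨eball x ((δ / 2 : ℝ≥0) : ℝ≥0∞), eball_mem_nhds x ?_, lt_top_iff_ne_top.2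
      (hpos x _ ?_ ?_).2⟩⟩
    · exact_mod_cast half_pos hδ
    · exact_mod_cast half_pos hδ
    · exact_mod_cast half_lt_self hδ
  have hfin : IsFiniteMeasure ν := ⟨isCompact_univ.measure_lt_top⟩
  have hev : ∀ c : ℝ≥0, 1 < c → ∀ x, ∃ η > (0 : ℝ≥0), η < δ ∧ ∀ r : ℝ≥0, 0 < r → r < η →
      μ (eball x (r : ℝ≥0∞)) ≤ c * ν (eball x (r : ℝ≥0∞)) := by
    intro c hc x
    have h1 : ∀ᶠ r : ℝ≥0∞ in 𝓝[>] 0, μ (eball x r) / ν (eball x r) < c :=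
      eventually_lt_of_limsup_lt ((h x).trans_lt (by exact_mod_cast hc))
    rw [Filter.Eventually, mem_nhdsGT_iff_exists_Ioo_subset' (zero_lt_one' ℝ≥0∞)] at h1
    obtain ⟨u, hu, hsub⟩ := h1
    obtain ⟨η, h0, h1⟩ := ENNReal.lt_iff_exists_nnreal_btwn.1
      (lt_min (show (0 : ℝ≥0∞) < u from hu) (show (0 : ℝ≥0∞) < δ by exact_mod_cast hδ))
    refine ⟨η, by exact_mod_cast h0, by exact_mod_cast h1.trans_le (min_le_right _ _), ?_⟩
    intro r hr hrη
    have hrη' : (r : ℝ≥0∞) < η := by exact_mod_cast hrη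
    have hr' : (0 : ℝ≥0∞) < r := by exact_mod_cast hr
    obtain ⟨hn0, hnt⟩ := hpos x r hr' (hrη'.trans (h1.trans_le (min_le_right _ _)))
    have := hsub ⟨hr', hrη'.trans (h1.trans_le (min_le_left _ _))⟩
    exact (ENNReal.div_le_iff hn0 hnt).1 (le_of_lt this)
  -- Any constant above `1` works here; `2` gives ball masses of at most `2 * b * r ^ d`.
  have hac : μ ≪ ν := by
    refine AbsolutelyContinuous.trans (absolutelyContinuous_hausdorffMeasure (k := d)
      (C := 2 * b) fun x => ?_) hνd
    obtain ⟨η, hη, hηδ, hx⟩ := hev 2 one_lt_two x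
    refine ⟨η, hη, fun r hr hrη => (hx r hr hrη).trans ?_⟩
    push_cast
    rw [mul_assoc]
    gcongr
    exact (hν x r hr (hrη.trans hηδ)).2
  have hclosed : ∀ c : ℝ≥0, 1 < c → ∀ x, ∃ η > (0 : ℝ≥0), ∀ r : ℝ≥0, 0 < r → r < η →
      μ (closedEBall x (r : ℝ≥0∞)) ≤ c * ν (closedEBall x (r : ℝ≥0∞)) := by
    intro c hc x
    obtain ⟨η, hη, hηδ, hx⟩ := hev c hc x
    refine ⟨η, hη, fun r hr hrη => ?_⟩
    -- A closed ball is a decreasing intersection of open balls, so finiteness of `ν` transfers the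
    -- bound to it.
    have hinter : ⋂ s > r, eball x (s : ℝ≥0∞) = closedEBall x (r : ℝ≥0∞) := by
      ext y
      simp only [mem_iInter, mem_eball, mem_closedEBall]
      refine ⟨fun hy => le_of_forall_gt_imp_ge_of_dense fun s hs => ?_, fun hy s hs =>
        hy.trans_lt (by exact_mod_cast hs)⟩
      obtain ⟨q, hq1, hq2⟩ := ENNReal.lt_iff_exists_nnreal_btwn.1 hs
      exact ((hy q (by exact_mod_cast hq1)).trans hq2).le
    have hlim := tendsto_measure_biInter_gt (μ := ν) (a := r)
      (s := fun s : ℝ≥0 => eball x (s : ℝ≥0∞))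
      (fun s _ => isOpen_eball.measurableSet.nullMeasurableSet)
      (fun i j _ hij => eball_subset_eball (by exact_mod_cast hij))
      ⟨r + 1, lt_add_one r, measure_ne_top _ _⟩
    rw [hinter] at hlim
    refine ge_of_tendsto (ENNReal.Tendsto.const_mul hlim (Or.inr ENNReal.coe_ne_top)) ?_
    filter_upwards [Ioo_mem_nhdsGT hrη] with s hs
    refine (measure_mono ?_).trans (hx s (hr.trans hs.1) hs.2)
    exact fun y hy => (mem_closedEBall.1 hy).trans_lt (by exact_mod_cast hs.1)
  have hmul : ∀ c : ℝ≥0, 1 < c → μ ≤ c • ν := by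
    intro c hc
    have hsc : SecondCountableTopology X := inferInstance
    -- Doubling constant: the closed ball of radius `3 * r` lies in the open ball of radius `4 * r`,
    -- of mass at most `b * (4 * r) ^ d`. The bound `1 / 3` keeps `3 * r` below the truncation.
    refine @le_of_closedBall_le_of_doubling X (PseudoEMetricSpace.truncate X) hsc _ _ μ ν hloc hac
      (b * 4 ^ d / a) (min (δ / 4) (1 / 3) : ℝ≥0) (by positivity) ?_ c ?_
    · intro x r hr hrδ
      lift r to ℝ≥0 using hr.le
      have hr0 : 0 < r := by exact_mod_cast hr
      have hr1 : r < δ / 4 := (NNReal.coe_lt_coe.1 hrδ).trans_le (min_le_left _ _)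
      have hr2 : r < 1 / 3 := (NNReal.coe_lt_coe.1 hrδ).trans_le (min_le_right _ _)
      have hr3 : (r : ℝ) < 1 / 3 := by exact_mod_cast hr2
      have hr4 : 4 * r < δ := by
        rw [lt_div_iff₀ (by norm_num)] at hr1
        rwa [mul_comm]
      rw [PseudoEMetricSpace.closedBall_truncate x (by positivity) (by linarith),
        PseudoEMetricSpace.closedBall_truncate x (by positivity) (by linarith)]
      have h3 : ENNReal.ofReal (3 * r) = ((3 * r : ℝ≥0) : ℝ≥0∞) := by
        rw [← ENNReal.ofReal_coe_nnreal]; push_cast; rfl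
      rw [h3, ENNReal.ofReal_coe_nnreal]
      have hrδ' : r < δ := lt_of_le_of_lt (le_mul_of_one_le_left zero_le (by norm_num)) hr4
      calc ν (closedEBall x ((3 * r : ℝ≥0) : ℝ≥0∞))
          ≤ ν (eball x ((4 * r : ℝ≥0) : ℝ≥0∞)) := by
            refine measure_mono fun y hy => (mem_closedEBall.1 hy).trans_lt ?_
            rw [ENNReal.coe_lt_coe]
            exact mul_lt_mul_of_pos_right (by norm_num) hr0
        _ ≤ b * ((4 * r : ℝ≥0) : ℝ≥0∞) ^ d := (hν x _ (by positivity) hr4).2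
        _ = ((b * 4 ^ d / a : ℝ≥0) : ℝ≥0∞) * (a * r ^ d) := by
            norm_cast
            rw [mul_pow]
            field_simp
            push_cast
            rfl
        _ ≤ ((b * 4 ^ d / a : ℝ≥0) : ℝ≥0∞) * ν (closedEBall x (r : ℝ≥0∞)) := by
            gcongr
            exact (hν x r hr0 hrδ').1.trans (measure_mono eball_subset_closedEBall)
    · intro x
      obtain ⟨η, hη, hx⟩ := hclosed c hc x
      filter_upwards [Ioo_mem_nhdsGT (show (0 : ℝ) < min (η : ℝ) 1 by positivity)] with r hr
      rw [PseudoEMetricSpace.closedBall_truncate x hr.1.le (hr.2.trans_le (min_le_right _ _))]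
      lift r to ℝ≥0 using hr.1.le
      rw [ENNReal.ofReal_coe_nnreal]
      exact hx r (by exact_mod_cast hr.1) (by exact_mod_cast hr.2.trans_le (min_le_left _ _))
  -- Let `c` decrease to `1`.
  refine Measure.le_intro fun s _ _ => ?_
  have hlim : Tendsto (fun c : ℝ≥0 => (c : ℝ≥0∞) * ν s) (𝓝[>] 1) (𝓝 (((1 : ℝ≥0) : ℝ≥0∞) * ν s)) :=
    ENNReal.Tendsto.mul_const (ENNReal.tendsto_coe.2 (tendsto_id.mono_left nhdsWithin_le_nhds))
      (Or.inr (measure_ne_top _ _))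
  rw [ENNReal.coe_one, one_mul] at hlim
  refine ge_of_tendsto hlim ?_
  filter_upwards [self_mem_nhdsWithin] with c hc
  exact hmul c hc s

end Density

/-! ### Arc length, the length measure, and endpoints of threads. -/

noncomputable section

namespace BitThreads

open Set Metric MeasureTheory Measure
open scoped NNReal

namespace Curve

variable {M : Type*} [PseudoEMetricSpace M] (c : Curve M)

theorem edist_le {s t : ℝ} (hs : s ∈ Icc 0 c.length) (ht : t ∈ Icc 0 c.length) (hst : s ≤ t) :
    edist (c.toFun s) (c.toFun t) ≤ ENNReal.ofReal (t - s) := by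
  have := c.unitSpeed hs ht
  rw [NNReal.coe_one, one_mul] at this
  rw [← this]
  exact eVariationOn.edist_le _ ⟨hs, le_rfl, hst⟩ ⟨ht, hst, le_rfl⟩

theorem lipschitzOnWith : LipschitzOnWith 1 c.toFun (Icc 0 c.length) := by
  intro s hs t ht
  rw [ENNReal.coe_one, one_mul, edist_dist]
  rcases le_total s t with h | h
  · refine (c.edist_le hs ht h).trans_eq ?_
    rw [Real.dist_eq, abs_sub_comm, abs_of_nonneg (sub_nonneg.2 h)]
  · rw [edist_comm]
    refine (c.edist_le ht hs h).trans_eq ?_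
    rw [Real.dist_eq, abs_of_nonneg (sub_nonneg.2 h)]

/-- A curve has length at least `r` in the ball of radius `2 r` around a point at distance less
than `r` from its source. -/
theorem le_lengthIn_of_source_mem {x : M} {r : ℝ≥0} (hr : (r : ℝ) ≤ c.length)
    (hx : c.source ∈ eball x (r : ℝ≥0∞)) :
    (r : ℝ≥0∞) ≤ c.lengthIn (eball x ((2 * r : ℝ≥0) : ℝ≥0∞)) := by
  calc (r : ℝ≥0∞) = volume (Icc 0 (r : ℝ)) := by simp [Real.volume_Icc]
    _ ≤ _ := by
      refine measure_mono fun s hs => ⟨⟨hs.1, hs.2.trans hr⟩, ?_⟩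
      have h1 := c.edist_le ⟨le_rfl, c.length_pos.le⟩ ⟨hs.1, hs.2.trans hr⟩ hs.1
      have h2 : ENNReal.ofReal (s - 0) ≤ r := by
        rw [sub_zero]
        exact ENNReal.ofReal_le_of_le_toReal hs.2
      rw [mem_preimage, mem_eball, two_mul, ENNReal.coe_add]
      rw [edist_comm] at h1
      exact (edist_triangle _ c.source _).trans_lt
        (ENNReal.add_lt_add_of_le_of_lt ((h1.trans h2).trans_lt ENNReal.coe_lt_top).ne
          (h1.trans h2) hx)

/-- A curve has length at least `r` in the ball of radius `2 r` around a point at distance less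
than `r` from its target. -/
theorem le_lengthIn_of_target_mem {x : M} {r : ℝ≥0} (hr : (r : ℝ) ≤ c.length)
    (hx : c.target ∈ eball x (r : ℝ≥0∞)) :
    (r : ℝ≥0∞) ≤ c.lengthIn (eball x ((2 * r : ℝ≥0) : ℝ≥0∞)) := by
  calc (r : ℝ≥0∞) = volume (Icc (c.length - r) c.length) := by simp [Real.volume_Icc]
    _ ≤ _ := by
      refine measure_mono fun s hs => ?_
      have hs0 : s ∈ Icc 0 c.length := ⟨by linarith [hs.1], hs.2⟩
      refine ⟨hs0, ?_⟩
      have h1 := c.edist_le hs0 ⟨c.length_pos.le, le_rfl⟩ hs.2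
      have h2 : ENNReal.ofReal (c.length - s) ≤ r :=
        ENNReal.ofReal_le_of_le_toReal (by simpa using by linarith [hs.1])
      rw [mem_preimage, mem_eball, two_mul, ENNReal.coe_add]
      exact (edist_triangle _ c.target _).trans_lt
        (ENNReal.add_lt_add_of_le_of_lt ((h1.trans h2).trans_lt ENNReal.coe_lt_top).ne
          (h1.trans h2) hx)

variable [MeasurableSpace M]

/-- The arc length measure of a curve. -/
def arcMeasure : Measure M := (volume.restrict (Icc 0 c.length)).map c.toFun

variable [BorelSpace M]

theorem aemeasurable : AEMeasurable c.toFun (volume.restrict (Icc 0 c.length)) :=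
  c.lipschitzOnWith.continuousOn.aemeasurable measurableSet_Icc

theorem arcMeasure_apply {B : Set M} (hB : MeasurableSet B) : c.arcMeasure B = c.lengthIn B := by
  rw [arcMeasure, map_apply_of_aemeasurable c.aemeasurable hB, restrict_apply' measurableSet_Icc,
    inter_comm, lengthIn]

theorem lintegral_arcMeasure {f : M → ℝ≥0∞} (hf : Measurable f) :
    ∫⁻ x, f x ∂c.arcMeasure = c.lineIntegral f :=
  lintegral_map' hf.aemeasurable c.aemeasurable

end Curve

namespace ThreadConfiguration

variable {d : ℕ} [NeZero d] {M : Type*} [EMetricSpace M] [MeasurableSpace M] [BorelSpace M]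
  [ChartedSpace (EuclideanHalfSpace d) M] {T : Type*} [MeasurableSpace T]
  (K : ThreadConfiguration d M T)

/-- The measure on `M` given by the total length of threads. -/
def lengthMeasure : Measure M := K.count.bind fun t => (K.thread t).arcMeasure

theorem measurable_arcMeasure : Measurable fun t => (K.thread t).arcMeasure := by
  refine measurable_of_measurable_coe _ fun B hB => ?_
  simpa only [Curve.arcMeasure_apply _ hB] using K.measurable_lengthIn B hB

theorem lengthMeasure_apply {B : Set M} (hB : MeasurableSet B) :
    K.lengthMeasure B = K.totalLength B := by
  rw [lengthMeasure, bind_apply hB K.measurable_arcMeasure.aemeasurable, totalLength]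
  simp only [Curve.arcMeasure_apply _ hB]

theorem lintegral_lengthMeasure {f : M → ℝ≥0∞} (hf : Measurable f) :
    ∫⁻ x, f x ∂K.lengthMeasure = ∫⁻ t, (K.thread t).lineIntegral f ∂K.count := by
  rw [lengthMeasure, lintegral_bind K.measurable_arcMeasure.aemeasurable hf.aemeasurable]
  simp only [Curve.lintegral_arcMeasure _ hf]

/-- If the total length in small balls is `O(r ^ d)`, then almost no thread has an endpoint in a
given set of vanishing area. -/
theorem count_endpoint_mem_eq_zero {b δ : ℝ≥0} (hδ : 0 < δ)
    (hK : ∀ x : M, ∀ r : ℝ≥0, 0 < r → r < δ →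
      K.totalLength (eball x (r : ℝ≥0∞)) ≤ b * r ^ d)
    {Z : Set M} (hZ : area d Z = 0) {e : T → M}
    (he : ∀ t x, ∀ r : ℝ≥0, (r : ℝ) ≤ (K.thread t).length → e t ∈ eball x (r : ℝ≥0∞) →
      (r : ℝ≥0∞) ≤ (K.thread t).lengthIn (eball x ((2 * r : ℝ≥0) : ℝ≥0∞))) :
    K.count {t | e t ∈ Z} = 0 := by
  have hZ' : (μH[((d - 1 : ℕ) : ℝ)] : Measure M) Z = 0 := by
    rw [area, euclideanHausdorffMeasure_def, Measure.smul_apply, ENNReal.smul_def, smul_eq_mul,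
      mul_eq_zero] at hZ
    refine hZ.resolve_left ?_
    exact_mod_cast addHaarScalarFactor_volume_hausdorffMeasure_ne_zero _
  -- The length estimate at an endpoint needs `r` at most the length of the thread; lengths are
  -- positive, so countably many thresholds suffice.
  let L : ℕ → Set T := fun n => {t | 1 / ((n : ℝ) + 1) < (K.thread t).length}
  have hcover : {t | e t ∈ Z} ⊆ ⋃ n, e ⁻¹' Z ∩ L n := by
    intro t ht
    obtain ⟨n, hn⟩ := exists_nat_one_div_lt (K.thread t).length_pos
    exact mem_iUnion.2 ⟨n, ht, hn⟩
  refine measure_mono_null hcover (measure_iUnion_null fun n => ?_)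
  -- The endpoint map is not assumed measurable, hence a pushforward of outer measures.
  have key := (OuterMeasure.map e
    (OuterMeasure.restrict (L n) K.count.toOuterMeasure)).eq_zero_of_hausdorffMeasure_eq_zero
    (s := Z) (k := d - 1) (C := b * 2 ^ d) (δ := min (δ / 2) (1 / ((n : ℝ≥0) + 1)))
    (by positivity) ?_ hZ'
  · simpa using key
  intro x _ r hr hrδ
  have hr1 : 2 * r < δ := by
    have := hrδ.trans_le (min_le_left _ _)
    rw [lt_div_iff₀ (by norm_num)] at this
    rwa [mul_comm]
  have hr2 : (r : ℝ) < 1 / ((n : ℝ) + 1) := by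
    exact_mod_cast NNReal.coe_lt_coe.2 (hrδ.trans_le (min_le_right _ _))
  have hr0 : (r : ℝ≥0∞) ≠ 0 := by exact_mod_cast hr.ne'
  rw [OuterMeasure.map_apply, OuterMeasure.restrict_apply, Measure.coe_toOuterMeasure]
  set S := e ⁻¹' (Z ∩ eball x (r : ℝ≥0∞)) ∩ L n
  -- Markov's inequality in the ball of radius `2 * r`; cancelling one factor `r` lowers the
  -- exponent to `d - 1`.
  have hmarkov : (r : ℝ≥0∞) * K.count S ≤ r * (((b * 2 ^ d : ℝ≥0) : ℝ≥0∞) * r ^ (d - 1)) :=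
    calc (r : ℝ≥0∞) * K.count S
        ≤ r * K.count {t | (r : ℝ≥0∞) ≤
            (K.thread t).lengthIn (eball x ((2 * r : ℝ≥0) : ℝ≥0∞))} := by
          refine mul_le_mul_right (measure_mono fun t ht => ?_) _
          exact he t x r (hr2.trans ht.2).le ht.1.2
      _ ≤ K.totalLength (eball x ((2 * r : ℝ≥0) : ℝ≥0∞)) :=
          mul_meas_ge_le_lintegral (K.measurable_lengthIn _ isOpen_eball.measurableSet) _
      _ ≤ b * ((2 * r : ℝ≥0) : ℝ≥0∞) ^ d := hK x _ (by positivity) hr1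
      _ = _ := by
          rw [← Nat.succ_pred_eq_of_ne_zero (NeZero.ne d)]
          push_cast
          simp only [Nat.pred_eq_sub_one, Nat.succ_eq_add_one]
          ring
  exact (ENNReal.mul_le_mul_iff_right hr0 ENNReal.coe_ne_top).1 hmarkov

end ThreadConfiguration

theorem IsElementary.eq_of_mem {d : ℕ} [NeZero d] {M : Type*} [EMetricSpace M] [MeasurableSpace M]
    [BorelSpace M] [ChartedSpace (EuclideanHalfSpace d) M] {n : ℕ} {A : Fin n → Set M}
    (hA : IsElementary d A) {x : M} {i j : Fin n} (hi : x ∈ bdryInterior d (A i))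
    (hj : x ∈ bdryInterior d (A j)) : i = j := by
  by_contra h
  exact disjoint_left.1 (hA.nonoverlapping i j h) hi hj

/-- A curve whose endpoints avoid the relative boundaries of the regions connects at most
`∫_c ds lam` of the composite regions in the family to their complements. -/
theorem PathConstraints.card_connects_le {d : ℕ} [NeZero d] {M : Type*} [EMetricSpace M]
    [MeasurableSpace M] [BorelSpace M] [ChartedSpace (EuclideanHalfSpace d) M] {n : ℕ}
    {A : Fin n → Set M} (hA : IsElementary d A) {F : Finset (Finset (Fin n))} {lam : M → ℝ}
    (hlam : PathConstraints d A F lam) (c : Curve M)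
    (hs : ∀ i, c.source ∈ A i → c.source ∈ bdryInterior d (A i))
    (ht : ∀ i, c.target ∈ A i → c.target ∈ bdryInterior d (A i)) :
    ∑ I ∈ F, {c : Curve M | c.Connects (composite A I) (composite A Iᶜ)}.indicator 1 c ≤
      c.lineIntegral fun x => ENNReal.ofReal (lam x) := by
  classical
  have hconn : ∀ I, c.Connects (composite A I) (composite A Iᶜ) → ∃ i j,
      c.IsFromTo (bdryInterior d (A i)) (bdryInterior d (A j)) ∧
        ((i ∈ I ∧ j ∉ I) ∨ (j ∈ I ∧ i ∉ I)) := by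
    intro I hI
    simp only [Curve.Connects, Curve.IsFromTo, composite, mem_iUnion, Finset.mem_compl,
      exists_prop] at hI
    rcases hI with ⟨⟨i, hi, hi'⟩, j, hj, hj'⟩ | ⟨⟨i, hi, hi'⟩, j, hj, hj'⟩
    · exact ⟨i, j, ⟨hs i hi', ht j hj'⟩, Or.inl ⟨hi, hj⟩⟩
    · exact ⟨i, j, ⟨hs i hi', ht j hj'⟩, Or.inr ⟨hj, hi⟩⟩
  simp only [indicator_apply, mem_ofPred_eq, Pi.one_apply, Finset.sum_boole]
  rcases (F.filter fun I => c.Connects (composite A I) (composite A Iᶜ)).eq_empty_or_nonempty with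
    h0 | ⟨I, hI⟩
  · simp [h0]
  obtain ⟨i, j, hij, -⟩ := hconn I (Finset.mem_filter.1 hI).2
  refine le_trans ?_ (hlam i j c hij)
  rw [symSepCount, sepCount, sepCount]
  norm_cast
  refine le_trans (Finset.card_le_card fun J hJ => ?_) (Finset.card_union_le _ _)
  obtain ⟨hJF, hJ⟩ := Finset.mem_filter.1 hJ
  obtain ⟨k, l, hkl, h⟩ := hconn J hJ
  -- Relative interiors are disjoint, so the endpoints determine `i` and `j`, and every connected
  -- `J` separates this same pair.
  obtain rfl := hA.eq_of_mem hij.1 hkl.1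
  obtain rfl := hA.eq_of_mem hij.2 hkl.2
  simpa only [Finset.mem_union, Finset.mem_filter, hJF, true_and] using h

end BitThreads

end

/-! ### The weak duality inequality and the obstruction to locking. -/

theorem theorem2p2 (d : ℕ) [NeZero d]
    {M : Type*} [EMetricSpace M] [CompactSpace M] [MeasurableSpace M] [BorelSpace M]
    [ChartedSpace (EuclideanHalfSpace d) M] [IsManifold (𝓡∂ d) ∞ M]
    [Bundle.RiemannianBundle (fun x : M => TangentSpace (𝓡∂ d) x)]
    [IsContMDiffRiemannianBundle (𝓡∂ d) ∞ (EuclideanSpace ℝ (Fin d))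
      (fun x : M => TangentSpace (𝓡∂ d) x)]
    [IsRiemannianManifold (𝓡∂ d) M]
    {n : ℕ} (A : Fin n → Set M) (hA : BitThreads.IsElementary d A)
    (F : Finset (Finset (Fin n)))
    (lam : M → ℝ) (hlam_meas : Measurable lam) (hlam_nonneg : ∀ x, 0 ≤ lam x)
    (hlam_path : BitThreads.PathConstraints d A F lam)
    {T : Type*} [MeasurableSpace T] (K : BitThreads.ThreadConfiguration d M T)
    (hK : ∀ x, K.volumeDensity x ≤ 1) :
    (∑ I ∈ F, K.crossNumber A I ≤ ∫⁻ x, ENNReal.ofReal (lam x) ∂(BitThreads.riemVolume d M)) ∧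
      ((∫⁻ x, ENNReal.ofReal (lam x) ∂(BitThreads.riemVolume d M) <
          ∑ I ∈ F, BitThreads.entropy d (BitThreads.composite A I)) →
        ¬ ∀ I ∈ F, K.Locks A I) := by
  open BitThreads MeasureTheory Measure Set in
  suffices hmain : ∑ I ∈ F, K.crossNumber A I ≤
      ∫⁻ x, ENNReal.ofReal (lam x) ∂(riemVolume d M) by
    refine ⟨hmain, fun hlt hlock => hlt.not_ge ?_⟩
    rwa [← Finset.sum_congr rfl hlock]
  have : IsManifold (𝓡∂ d) 1 M := IsManifold.of_le (n := ∞) (by exact_mod_cast le_top)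
  have : IsContinuousRiemannianBundle (EuclideanSpace ℝ (Fin d))
      (fun x : M => TangentSpace (𝓡∂ d) x) := by
    obtain ⟨g, hg, hgg⟩ := IsContMDiffRiemannianBundle.exists_contMDiff (IB := 𝓡∂ d) (n := ∞)
      (F := EuclideanSpace ℝ (Fin d)) (E := fun x : M => TangentSpace (𝓡∂ d) x)
    exact ⟨g, hg.continuous, hgg⟩
  obtain ⟨a, ha, b, δ, hδ, hvol⟩ := exists_eball_volume_bounds d (M := M)
  have hle : K.lengthMeasure ≤ riemVolume d M := by
    refine Measure.le_of_limsup_eball_le_one (ν := riemVolume d M) ?_ ha hδ hvol fun x => ?_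
    · intro s hs
      rw [riemVolume, euclideanHausdorffMeasure_def, Measure.smul_apply, ENNReal.smul_def,
        smul_eq_mul, mul_eq_zero] at hs
      refine hs.resolve_left ?_
      exact_mod_cast addHaarScalarFactor_volume_hausdorffMeasure_ne_zero _
    · simp only [K.lengthMeasure_apply Metric.isOpen_eball.measurableSet]
      exact hK x
  have hlen : ∀ x : M, ∀ r : NNReal, 0 < r → r < δ →
      K.totalLength (Metric.eball x (r : ℝ≥0∞)) ≤ b * r ^ d := fun x r hr hrδ => by
    rw [← K.lengthMeasure_apply Metric.isOpen_eball.measurableSet]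
    exact (hle _).trans (hvol x r hr hrδ).2
  -- The relative boundary of each region has zero area, so almost no thread starts on it.
  have hsource : ∀ᵐ t ∂K.count, ∀ i, (K.thread t).source ∈ A i →
      (K.thread t).source ∈ bdryInterior d (A i) := by
    refine ae_all_iff.2 fun i => ?_
    have := K.count_endpoint_mem_eq_zero hδ hlen (hA.isBdryRegion i).area_bdry
      (e := fun t => (K.thread t).source) fun t x r => (K.thread t).le_lengthIn_of_source_mem
    filter_upwards [measure_eq_zero_iff_ae_notMem.1 this] with t ht hi
    by_contra h
    exact ht ⟨hi, h⟩
  have htarget : ∀ᵐ t ∂K.count, ∀ i, (K.thread t).target ∈ A i →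
      (K.thread t).target ∈ bdryInterior d (A i) := by
    refine ae_all_iff.2 fun i => ?_
    have := K.count_endpoint_mem_eq_zero hδ hlen (hA.isBdryRegion i).area_bdry
      (e := fun t => (K.thread t).target) fun t x r => (K.thread t).le_lengthIn_of_target_mem
    filter_upwards [measure_eq_zero_iff_ae_notMem.1 this] with t ht hi
    by_contra h
    exact ht ⟨hi, h⟩
  have hmeas : ∀ I : Finset (Fin n), MeasurableSet (composite A I) := fun I =>
    I.measurableSet_biUnion fun i _ => (hA.isBdryRegion i).isClosed.measurableSet
  have hS : ∀ I : Finset (Fin n), MeasurableSet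
      {t | (K.thread t).Connects (composite A I) (composite A Iᶜ)} := fun I =>
    K.measurableSet_connects _ _ (hmeas I) (hmeas Iᶜ)
  calc ∑ I ∈ F, K.crossNumber A I
      = ∑ I ∈ F, ∫⁻ t, {t | (K.thread t).Connects (composite A I)
          (composite A Iᶜ)}.indicator 1 t ∂K.count :=
        Finset.sum_congr rfl fun I _ => (lintegral_indicator_one (hS I)).symm
    _ = ∫⁻ t, ∑ I ∈ F, {t | (K.thread t).Connects (composite A I)
          (composite A Iᶜ)}.indicator 1 t ∂K.count :=
        (lintegral_finsetSum _ fun I _ => measurable_one.indicator (hS I)).symm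
    _ ≤ ∫⁻ t, (K.thread t).lineIntegral (fun x => ENNReal.ofReal (lam x)) ∂K.count := by
        refine lintegral_mono_ae ?_
        filter_upwards [hsource, htarget] with t hs ht
        exact hlam_path.card_connects_le hA (K.thread t) hs ht
    _ = ∫⁻ x, ENNReal.ofReal (lam x) ∂K.lengthMeasure :=
        (K.lintegral_lengthMeasure hlam_meas.ennreal_ofReal).symm
    _ ≤ ∫⁻ x, ENNReal.ofReal (lam x) ∂(riemVolume d M) := lintegral_mono' hle le_rfl
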